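/- Let $\ell, n_c \ge 1$ be integers, $\rho > 0$, $\kappa \ge 0$, and put $\mu_H=\sqrt{\kappa/(1+\kappa)}$, $\sigma_H^2=1/(1+\kappa)$. Consider the Rician block-fading channel $Y_k = H_k x_k + W_k$, $k=1,\dots,\ell$, with $x_k, Y_k\in\mathbb{C}^{n_c}$, where $H_k\sim\mathcal{CN}(\mu_H,\sigma_H^2)$ and $W_k\sim\mathcal{CN}(0,I_{n_c})$ are all mutually independent, and the realizations of the $H_k$ are known neither to the encoder nor to the decoder. An $(\ell,n_c,M,\epsilon,\rho)$-code ($M \ge 1$) consists of an encoder that maps each $m\in\{1,\dots,M\}$ to $\ell$ blocks $c_{m,1},\dots,c_{m,\ell}\in\mathbb{C}^{n_c}$ with $\|c_{m,k}\|^2=n_c\rho$ for all $k$, and a (measurable) decoder $g:\mathbb{C}^{n_c\ell}\to\{1,\dots,M\}$ whose average error probability $\frac1M\sum_{j=1}^M\Pr\{g(Y_1,\dots,Y_\ell)\ne j\mid \text{message } j \text{ is sent}\}$ is at most $\epsilon$. Let $$R^*=\sup\Big\{\tfrac{\log_2 M}{\ell n_c}:\ \text{an } (\ell,n_c,M,\epsilon,\rho)\text{-code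 exists}\Big\}$$ be the maximum coding rate in bits per channel use. Define $$\widetilde W_k=\big(\mu_H\sqrt{n_c\rho}+\sqrt{\sigma_H^2n_c\rho+1}\;W_{k,1},\,W_{k,2},\dots,W_{k,n_c}\big)$$ and $$S_k=\frac{\mu_H^2}{\sigma_H^2}+\|\widetilde W_k\|^2-\|W_k\|^2-\log\frac{\Gamma(n_c)\,(\sigma_H^2n_c\rho+1)}{\sigma_H^2}-\log\int_0^\infty \frac{e^{-(\rho n_c+\sigma_H^{-2})z}}{\big(\sqrt{\|\widetilde W_k\|^2\rho n_c z}\big)^{n_c-1}}\,I_0\!\Big(2\sqrt{z\mu_H^2/\sigma_H^4}\Big)\,I_{n_c-1}\!\Big(2\sqrt{\|\widetilde W_k\|^2\rho n_c z}\Big)\,dz,$$ where $I_\nu$ is the modified Bessel function of the first kind and $\log$ is the natural logarithm. Then, for every real $\epsilon$, $$R^*\ \le\ \inf_{\lambda\ge0}\ \frac{1}{\ell n_c\log 2}\Big(\lambda-\log\Big[\Pr\Big\{\sum_{k=1}^{\ell}S_k\le\lambda\Big\}-\epsilon\Big]^+\Big),$$ where $[a]^+=\max\{0,a\}$, $\log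 0=-\infty$, and both sides are extended real numbers (with $\sup\emptyset=-\infty$). -/

import Mathlib

open MeasureTheory ProbabilityTheory

namespace RicianBlockFading

noncomputable section

/-- The circularly-symmetric complex Gaussian law `CN(m, v)` on `ℂ`: real and imaginary parts are
independent real Gaussians with means `Re m`, `Im m` and variance `v / 2` each. -/
def complexGaussian (m : ℂ) (v : ℝ) : Measure ℂ :=
  ((gaussianReal m.re (v / 2).toNNReal).prod (gaussianReal m.im (v / 2).toNNReal)).map
    (fun p : ℝ × ℝ => (⟨p.1, p.2⟩ : ℂ))

/-- Mean of the fading coefficient, `μ_H = √(κ / (1 + κ))`. -/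
def muH (κ : ℝ) : ℝ := Real.sqrt (κ / (1 + κ))

/-- Variance of the fading coefficient, `σ_H² = 1 / (1 + κ)`. -/
def varH (κ : ℝ) : ℝ := 1 / (1 + κ)

/-- The space of channel inputs and outputs: `ℓ` blocks, each a vector in `ℂ ^ nc`. -/
abbrev Blocks (ℓ nc : ℕ) : Type := Fin ℓ → Fin nc → ℂ

/-- Law of the fading coefficients `(H_1, …, H_ℓ)`: i.i.d. `CN(μ_H, σ_H²)`. -/
def fadingLaw (κ : ℝ) (ℓ : ℕ) : Measure (Fin ℓ → ℂ) :=
  Measure.pi fun _ => complexGaussian (muH κ : ℂ) (varH κ)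

/-- Law of the noise `(W_1, …, W_ℓ)`: independent `CN(0, I_nc)` vectors. -/
def noiseLaw (ℓ nc : ℕ) : Measure (Blocks ℓ nc) :=
  Measure.pi fun _ => Measure.pi fun _ => complexGaussian 0 1

/-- Law of the channel output `Y_k = H_k x_k + W_k`, `k = 1, …, ℓ`, for the input `x`; the fading
and the noise are independent and unknown to both encoder and decoder. -/
def outputLaw (κ : ℝ) {ℓ nc : ℕ} (x : Blocks ℓ nc) : Measure (Blocks ℓ nc) :=
  ((fadingLaw κ ℓ).prod (noiseLaw ℓ nc)).map
    (fun p => fun k i => p.1 k * x k i + p.2 k i)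

/-- Squared `l²`-norm of a vector in `ℂ ^ nc`. -/
def normSqVec {nc : ℕ} (y : Fin nc → ℂ) : ℝ := ∑ i, ‖y i‖ ^ 2

/-- An `(ℓ, nc, M, ε, ρ)`-code for the Rician block-fading channel with Rician factor `κ`. -/
structure Code (κ : ℝ) (ℓ nc M : ℕ) (ε ρ : ℝ) where
  /-- There is at least one message. -/
  one_le : 1 ≤ M
  /-- The encoder. -/
  enc : Fin M → Blocks ℓ nc
  /-- The power constraint, on every subcodeword. -/
  power : ∀ m k, normSqVec (enc m k) = nc * ρ
  /-- The decoder. -/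
  dec : Blocks ℓ nc → Fin M
  /-- The decoder is a measurable map. -/
  measurable_dec : Measurable dec
  /-- The average error probability is at most `ε`. -/
  avg_error : (1 / (M : ℝ)) * ∑ j, (outputLaw κ (enc j)).real {y | dec y ≠ j} ≤ ε

/-- The maximum coding rate `R*`, in bits per channel use, as a supremum of extended reals (so it
is `⊤` if the achievable rates are unbounded). -/
def maxRate (κ : ℝ) (ℓ nc : ℕ) (ε ρ : ℝ) : EReal :=
  sSup {r : EReal | ∃ M : ℕ, Nonempty (Code κ ℓ nc M ε ρ) ∧
    r = ((Real.logb 2 M / (ℓ * nc) : ℝ) : EReal)}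

/-- The modified Bessel function of the first kind `I_ν(x)`, of order `ν ∈ ℕ`. -/
def besselI (ν : ℕ) (x : ℝ) : ℝ :=
  ∑' m : ℕ, (x / 2) ^ (2 * m + ν) / ((m.factorial : ℝ) * ((m + ν).factorial : ℝ))

/-- The integral that appears in the output density induced by a shell code, as a function of
`s = ‖y‖²`. -/
def shellIntegral (κ : ℝ) (nc : ℕ) (ρ s : ℝ) : ℝ :=
  ∫ z in Set.Ioi (0 : ℝ),
    Real.exp (-((ρ * nc + (varH κ)⁻¹) * z)) / Real.sqrt (s * ρ * nc * z) ^ (nc - 1)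
      * besselI 0 (2 * Real.sqrt (z * |muH κ| ^ 2 / varH κ ^ 2))
      * besselI (nc - 1) (2 * Real.sqrt (s * ρ * nc * z))

/-- The vector `W̃ = (μ_H √(nc ρ) + √(σ_H² nc ρ + 1) W_1, W_2, …, W_nc)`. -/
def wTilde (κ : ℝ) {nc : ℕ} (ρ : ℝ) (w : Fin nc → ℂ) : Fin nc → ℂ := fun i =>
  if (i : ℕ) = 0 then
    ((muH κ * Real.sqrt (nc * ρ) : ℝ) : ℂ) + ((Real.sqrt (varH κ * nc * ρ + 1) : ℝ) : ℂ) * w i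
  else w i

/-- The random variable `S_k` as a function of the noise vector `w = W_k`. It is
`log (f_{Y|X}(W̃ | x) / f_Y(W̃))` for `x = (√(nc ρ), 0, …, 0)`, where `f_{Y|X}(· | x)` is the
density of `CN(μ_H x, σ_H² x xᴴ + I)` and `f_Y` is the output density induced by a shell code. -/
def S (κ : ℝ) {nc : ℕ} (ρ : ℝ) (w : Fin nc → ℂ) : ℝ :=
  |muH κ| ^ 2 / varH κ + normSqVec (wTilde κ ρ w) - normSqVec w
    - Real.log (Real.Gamma nc * (varH κ * nc * ρ + 1) / varH κ)
    - Real.log (shellIntegral κ nc ρ (normSqVec (wTilde κ ρ w)))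

/-- `Pr {∑ₖ S_k ≤ t}`. -/
def probSumLe (κ : ℝ) (ℓ nc : ℕ) (ρ t : ℝ) : ℝ :=
  (noiseLaw ℓ nc).real {w | ∑ k, S κ ρ (w k) ≤ t}

/-- The natural logarithm of the positive part, `log [a]⁺`, with `log 0 = -∞`. -/
def logPos (a : ℝ) : EReal := ENNReal.log (ENNReal.ofReal a)

end

end RicianBlockFading

namespace RicianBlockFading

noncomputable section

/-! ### Products of measures with densities -/

/-! This is a change-of-measure converse. Let `P_x` be the output law for the input `x` and `Q` a
fixed product measure of mass at most 1 on the output space. For every measurable `B`, splitting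
according to whether `dP_x/dQ ≤ e^t` gives `P_x(log dP_x/dQ ≤ t) ≤ e^t Q(B) + P_x(Bᶜ)`
(`noiseLaw_sum_S_le`). Take for `B` the decoding regions, which are disjoint and so have total
`Q`-mass at most 1. If the left side is the same number `p` for every codeword, summing over
messages yields `M (p - ε) ≤ e^t` (`Code.card_mul_le`); the theorem is the logarithm of this.

The left side does not depend on the codeword because of unitary symmetry. All blocks have the same
norm, so a unitary map carries `axisInput` to each of them; it preserves the noise law
(`map_blockNoise_of_normSqVec`) and hence `shellLaw`, whose density depends only on `‖y‖²`. For
`axisInput` the output is distributed as `W̃`, and there the log-likelihood ratio is `S`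
(`ae_likelihoodRatio_wTilde`).

The analytic part is that `shellLaw` has mass at most 1. Densities are taken relative to the
Gaussian noise law rather than Lebesgue measure, so this reduces to integrating Bessel series
termwise against the moments of `‖W‖²`. No identification of `shellLaw` with an actual output law is
required. -/

theorem lintegral_fin_prod_eq_prod {n : ℕ} {E : Fin n → Type*} {mE : ∀ i, MeasurableSpace (E i)}
    {μ : (i : Fin n) → Measure (E i)} [∀ i, SigmaFinite (μ i)] {f : (i : Fin n) → E i → ENNReal}
    (hf : ∀ i, Measurable (f i)) :
    ∫⁻ x, ∏ i, f i (x i) ∂(Measure.pi μ) = ∏ i, ∫⁻ x, f i x ∂(μ i) := by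
  induction n with
  | zero => simp
  | succ n ih =>
    calc
      _ = ∫⁻ x : E 0 × ((i : Fin n) → E (Fin.succ i)),
            f 0 x.1 * ∏ i : Fin n, f (Fin.succ i) (x.2 i)
            ∂((μ 0).prod (Measure.pi (fun i ↦ μ i.succ))) := by
          refine Eq.trans ?_ ((measurePreserving_piFinSuccAbove μ 0).lintegral_comp_emb
            (MeasurableEquiv.measurableEmbedding _)
            fun x => f 0 x.1 * ∏ i : Fin n, f (Fin.succ i) (x.2 i))
          refine lintegral_congr fun x => ?_
          rw [Fin.prod_univ_succ]
          rfl
      _ = (∫⁻ x, f 0 x ∂μ 0)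
            * ∏ i : Fin n, ∫⁻ (x : E (Fin.succ i)), f (Fin.succ i) x ∂(μ i.succ) := by
          rw [← ih fun i => hf _, ← lintegral_prod_mul (hf 0).aemeasurable]
          exact (Finset.measurable_prod _ fun i _ =>
            (hf i.succ).comp (measurable_pi_apply i)).aemeasurable
      _ = ∏ i, ∫⁻ x, f i x ∂(μ i) := by rw [Fin.prod_univ_succ]

theorem pi_withDensity {n : ℕ} {E : Fin n → Type*} {mE : ∀ i, MeasurableSpace (E i)}
    {μ : (i : Fin n) → Measure (E i)} [∀ i, SigmaFinite (μ i)] {f : (i : Fin n) → E i → ENNReal}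
    (hf : ∀ i, Measurable (f i)) [∀ i, SigmaFinite ((μ i).withDensity (f i))] :
    Measure.pi (fun i => (μ i).withDensity (f i)) =
      (Measure.pi μ).withDensity fun x => ∏ i, f i (x i) := by
  refine Measure.pi_eq fun s hs => ?_
  rw [withDensity_apply _ (MeasurableSet.univ_pi hs), ← lintegral_indicator (MeasurableSet.univ_pi hs)]
  have h : (Set.univ.pi s).indicator (fun x => ∏ i, f i (x i)) =
      fun x => ∏ i, (s i).indicator (f i) (x i) := by
    ext x
    by_cases hx : x ∈ Set.univ.pi s
    · rw [Set.indicator_of_mem hx]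
      exact Finset.prod_congr rfl fun i _ => by
        rw [Set.indicator_of_mem (hx i (Set.mem_univ i))]
    · rw [Set.indicator_of_notMem hx]
      simp only [Set.mem_univ_pi, not_forall] at hx
      obtain ⟨i, hi⟩ := hx
      exact (Finset.prod_eq_zero (Finset.mem_univ i) (Set.indicator_of_notMem hi _)).symm
  rw [h, lintegral_fin_prod_eq_prod fun i => (hf i).indicator (hs i)]
  exact Finset.prod_congr rfl fun i _ => by
    rw [withDensity_apply _ (hs i), lintegral_indicator (hs i)]

theorem map_withDensity_comp {α β : Type*} [MeasurableSpace α] [MeasurableSpace β]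
    {f : α → β} (hf : Measurable f) (μ : Measure α) {h : β → ENNReal} (hh : Measurable h) :
    (μ.withDensity fun x => h (f x)).map f = (μ.map f).withDensity h := by
  ext s hs
  rw [Measure.map_apply hf hs, withDensity_apply _ (hf hs), withDensity_apply _ hs,
    setLIntegral_map hs hh hf]

/-! ### Complex Gaussian laws -/

theorem measurable_complex_mk : Measurable fun p : ℝ × ℝ => (⟨p.1, p.2⟩ : ℂ) :=
  Complex.measurableEquivRealProd.symm.measurable

instance isProbabilityMeasure_complexGaussian (m : ℂ) (v : ℝ) :
    IsProbabilityMeasure (complexGaussian m v) :=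
  Measure.isProbabilityMeasure_map measurable_complex_mk.aemeasurable

theorem charFun_complexGaussian (m : ℂ) {v : ℝ} (hv : 0 ≤ v) (t : ℂ) :
    charFun (complexGaussian m v) t =
      Complex.exp ((t.re * m.re + t.im * m.im) * Complex.I - v * (t.re ^ 2 + t.im ^ 2) / 4) := by
  have h (x : ℝ × ℝ) : Complex.exp (inner ℝ (⟨x.1, x.2⟩ : ℂ) t * Complex.I) =
      Complex.exp (inner ℝ x.1 t.re * Complex.I) * Complex.exp (inner ℝ x.2 t.im * Complex.I) := by
    rw [← Complex.exp_add, ← add_mul, ← Complex.ofReal_add]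
    congr 3
    simp [Complex.inner]
  rw [charFun_apply, complexGaussian, integral_map measurable_complex_mk.aemeasurable
    (by fun_prop)]
  simp_rw [h]
  rw [integral_prod_mul (fun x : ℝ => Complex.exp (inner ℝ x t.re * Complex.I))
    (fun x : ℝ => Complex.exp (inner ℝ x t.im * Complex.I)), ← charFun_apply, ← charFun_apply,
    charFun_gaussianReal, charFun_gaussianReal, ← Complex.exp_add]
  have : (((v / 2).toNNReal : ℝ) : ℂ) = v / 2 := by
    rw [Real.coe_toNNReal _ (by positivity)]; push_cast; rfl
  rw [this]
  congr 1
  ring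

/-- Characteristic functions multiply under convolution, which also covers degenerate variances. -/
theorem complexGaussian_conv (m₁ m₂ : ℂ) {v₁ v₂ : ℝ} (h₁ : 0 ≤ v₁) (h₂ : 0 ≤ v₂) :
    (complexGaussian m₁ v₁).conv (complexGaussian m₂ v₂) = complexGaussian (m₁ + m₂) (v₁ + v₂) := by
  refine Measure.ext_of_charFun (funext fun t => ?_)
  rw [charFun_conv, charFun_complexGaussian _ h₁, charFun_complexGaussian _ h₂,
    charFun_complexGaussian _ (add_nonneg h₁ h₂), ← Complex.exp_add]
  congr 1
  simp
  ring

theorem complexGaussian_map_mul_add (m : ℂ) {v : ℝ} (hv : 0 ≤ v) (a : ℝ) (c : ℂ) :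
    (complexGaussian m v).map (fun z => c + (a : ℂ) * z) = complexGaussian (c + a * m) (a ^ 2 * v) := by
  have h1 (x₀ y : ℝ) : (gaussianReal x₀ (v / 2).toNNReal).map (fun x => y + a * x) =
      gaussianReal (y + a * x₀) (a ^ 2 * v / 2).toNNReal := by
    rw [show (fun x => y + a * x) = (fun x => y + x) ∘ fun x => a * x from rfl,
      ← Measure.map_map (by fun_prop) (by fun_prop), gaussianReal_map_const_mul,
      gaussianReal_map_const_add, add_comm]
    congr 1
    ext
    simp only [NNReal.coe_mul, NNReal.coe_mk]
    rw [Real.coe_toNNReal _ (by positivity), Real.coe_toNNReal _ (by positivity)]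
    ring
  rw [complexGaussian, Measure.map_map (by fun_prop) measurable_complex_mk, complexGaussian,
    show (c + a * m).re = c.re + a * m.re by simp, show (c + a * m).im = c.im + a * m.im by simp,
    ← h1, ← h1, Measure.map_prod_map _ _ (by fun_prop) (by fun_prop),
    Measure.map_map measurable_complex_mk (by fun_prop)]
  congr 1
  ext x
  apply Complex.ext <;> simp

/-- The density of `CN(m, v)` with respect to Lebesgue measure. -/
def complexGaussianPDF (m : ℂ) (v : ℝ) (z : ℂ) : ENNReal :=
  ENNReal.ofReal ((Real.pi * v)⁻¹ * Real.exp (-‖z - m‖ ^ 2 / v))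

theorem measurable_complexGaussianPDF (m : ℂ) (v : ℝ) : Measurable (complexGaussianPDF m v) := by
  unfold complexGaussianPDF
  fun_prop

theorem complexGaussian_eq_withDensity (m : ℂ) {v : ℝ} (hv : 0 < v) :
    complexGaussian m v = volume.withDensity (complexGaussianPDF m v) := by
  have hv' : (v / 2).toNNReal ≠ 0 := by simpa using hv
  have hvol : (volume : Measure (ℝ × ℝ)).map (fun p : ℝ × ℝ => (⟨p.1, p.2⟩ : ℂ)) = volume :=
    (Complex.volume_preserving_equiv_real_prod.symm _).map_eq
  rw [complexGaussian, gaussianReal_of_var_ne_zero _ hv', gaussianReal_of_var_ne_zero _ hv',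
    prod_withDensity (measurable_gaussianPDF _ _) (measurable_gaussianPDF _ _),
    ← Measure.volume_eq_prod, ← hvol, ← map_withDensity_comp measurable_complex_mk _
      (measurable_complexGaussianPDF m v)]
  refine congrArg (fun f => (volume.withDensity f).map _) (funext fun p => ?_)
  rw [gaussianPDF, gaussianPDF, complexGaussianPDF,
    ← ENNReal.ofReal_mul (gaussianPDFReal_nonneg _ _ _)]
  congr 1
  rw [gaussianPDFReal, gaussianPDFReal, Real.coe_toNNReal _ (by positivity), mul_mul_mul_comm,
    ← Real.exp_add, ← mul_inv, Real.mul_self_sqrt (by positivity)]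
  congr 2
  · ring
  · rw [← Complex.normSq_eq_norm_sq, Complex.normSq_apply]
    simp
    field_simp
    ring

/-- Under `CN(0, 1)` the variable `‖z‖²` is exponential with mean 1. -/
theorem lintegral_complexGaussian_norm_sq_pow (j : ℕ) :
    ∫⁻ z, ENNReal.ofReal ((‖z‖ ^ 2) ^ j) ∂(complexGaussian 0 1) = (j.factorial : ENNReal) := by
  have h := Complex.integral_rpow_mul_exp_neg_rpow (p := 2) (q := 2 * j) (by norm_num)
    (by have := j.cast_nonneg (α := ℝ); linarith)
  have hG : Real.Gamma ((2 * j + 2) / 2) = j.factorial := by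
    rw [← Real.Gamma_nat_eq_factorial]; congr 1; ring
  rw [hG] at h
  have hint := Integrable.of_integral_ne_zero (h.trans_ne (by positivity))
  have h' := ofReal_integral_eq_lintegral_ofReal hint (Filter.Eventually.of_forall fun z => by positivity)
  rw [h] at h'
  rw [complexGaussian_eq_withDensity _ one_pos, lintegral_withDensity_eq_lintegral_mul _
    (measurable_complexGaussianPDF _ _) (by fun_prop)]
  calc _ = ∫⁻ z : ℂ, ENNReal.ofReal Real.pi⁻¹ *
        ENNReal.ofReal (‖z‖ ^ (2 * j : ℝ) * Real.exp (-‖z‖ ^ (2 : ℝ))) := by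
        refine lintegral_congr fun z => ?_
        rw [Pi.mul_apply, complexGaussianPDF, ← ENNReal.ofReal_mul (by positivity),
          ← ENNReal.ofReal_mul (by positivity)]
        congr 1
        have e1 : ‖z‖ ^ (2 * j : ℝ) = (‖z‖ ^ 2) ^ j := by
          rw [← pow_mul]; exact_mod_cast Real.rpow_natCast ‖z‖ (2 * j)
        have e2 : ‖z‖ ^ (2 : ℝ) = ‖z‖ ^ 2 := by exact_mod_cast Real.rpow_natCast ‖z‖ 2
        rw [e1, e2]
        simp
        ring
    _ = _ := by
        rw [lintegral_const_mul _ (by fun_prop), ← h', ← ENNReal.ofReal_mul (by positivity),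
          ← ENNReal.ofReal_natCast]
        congr 1
        field_simp

/-! ### Moments of the squared norm of the noise in one block -/

/-- The law `CN(0, I_n)`. -/
def blockNoise (n : ℕ) : Measure (Fin n → ℂ) := Measure.pi fun _ => complexGaussian 0 1

instance isProbabilityMeasure_blockNoise (n : ℕ) : IsProbabilityMeasure (blockNoise n) := by
  unfold blockNoise; infer_instance

@[fun_prop]
theorem measurable_normSqVec {n : ℕ} : Measurable (normSqVec (nc := n)) := by
  unfold normSqVec; fun_prop

theorem normSqVec_nonneg {n : ℕ} (y : Fin n → ℂ) : 0 ≤ normSqVec y :=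
  Finset.sum_nonneg fun _ _ => by positivity

/-- Here `‖y‖²` is Gamma distributed with shape `d + 1`, so its moments are `(m + d)! / d!`. The
induction splits off one coordinate and expands the power of the sum binomially. -/
theorem lintegral_normSqVec_pow (d m : ℕ) :
    ∫⁻ y, ENNReal.ofReal (normSqVec y) ^ m ∂(blockNoise (d + 1)) =
      ((m.factorial * (m + d).choose d : ℕ) : ENNReal) := by
  induction d generalizing m with
  | zero =>
    have h := lintegral_fin_prod_eq_prod (n := 1) (μ := fun _ => complexGaussian 0 1)
      (f := fun _ z => ENNReal.ofReal ((‖z‖ ^ 2) ^ m)) (fun _ => by fun_prop)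
    simp only [Finset.univ_unique, Fin.default_eq_zero, Finset.prod_singleton,
      lintegral_complexGaussian_norm_sq_pow] at h
    rw [blockNoise]
    simp [normSqVec, ← h, ENNReal.ofReal_pow]
  | succ d ih =>
    have hsplit : ∫⁻ y, ENNReal.ofReal (normSqVec y) ^ m ∂(blockNoise (d + 1 + 1)) =
        ∫⁻ x : ℂ × (Fin (d + 1) → ℂ),
          (ENNReal.ofReal (‖x.1‖ ^ 2) + ENNReal.ofReal (normSqVec x.2)) ^ m
          ∂((complexGaussian 0 1).prod (blockNoise (d + 1))) := by
      refine Eq.trans ?_ ((measurePreserving_piFinSuccAbove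
        (fun _ : Fin (d + 1 + 1) => complexGaussian 0 1) 0).lintegral_comp_emb
        (MeasurableEquiv.measurableEmbedding _)
        fun x => (ENNReal.ofReal (‖x.1‖ ^ 2) + ENNReal.ofReal (normSqVec x.2)) ^ m)
      refine lintegral_congr fun y => ?_
      rw [← ENNReal.ofReal_add (by positivity) (normSqVec_nonneg _), normSqVec,
        Fin.sum_univ_succ]
      rfl
    rw [hsplit]
    simp_rw [add_pow]
    rw [lintegral_finsetSum _ fun i _ => by fun_prop]
    have hterm (j : ℕ) (hj : j ∈ Finset.range (m + 1)) :
        ∫⁻ x : ℂ × (Fin (d + 1) → ℂ), ENNReal.ofReal (‖x.1‖ ^ 2) ^ j *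
            ENNReal.ofReal (normSqVec x.2) ^ (m - j) * (m.choose j : ENNReal)
          ∂((complexGaussian 0 1).prod (blockNoise (d + 1))) =
        ((m.factorial * (m - j + d).choose d : ℕ) : ENNReal) := by
      have hjm : j ≤ m := Nat.lt_succ_iff.mp (Finset.mem_range.mp hj)
      rw [lintegral_mul_const _ (by fun_prop), lintegral_prod_mul
        (f := fun z : ℂ => ENNReal.ofReal (‖z‖ ^ 2) ^ j)
        (g := fun y : Fin (d + 1) → ℂ => ENNReal.ofReal (normSqVec y) ^ (m - j))
        (by fun_prop) (by fun_prop), ih]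
      have := lintegral_complexGaussian_norm_sq_pow j
      simp_rw [ENNReal.ofReal_pow (sq_nonneg _)] at this
      rw [this, ← Nat.choose_mul_factorial_mul_factorial hjm]
      push_cast
      ring
    rw [Finset.sum_congr rfl hterm, ← Nat.cast_sum, ← Finset.mul_sum]
    -- What remains is the hockey-stick identity for `∑ (m - j + d).choose d`.
    congr 2
    have hrefl := Finset.sum_range_reflect (fun j => (j + d).choose d) (m + 1)
    simp only [add_tsub_cancel_right] at hrefl
    rw [hrefl, show m + (d + 1) = m + d + 1 by ring, ← Nat.sum_Icc_choose, Finset.range_eq_Ico,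
      Finset.sum_Ico_add' (fun j => j.choose d) 0 (m + 1) d]
    congr 1
    ext; simp; omega

/-! ### Bessel functions -/

theorem hasSum_besselI (ν : ℕ) (x : ℝ) :
    HasSum (fun m : ℕ => (x / 2) ^ (2 * m + ν) / ((m.factorial : ℝ) * ((m + ν).factorial : ℝ)))
      (besselI ν x) := by
  refine Summable.hasSum ?_
  refine .of_norm_bounded (g := fun m : ℕ => |x / 2| ^ ν * (((x / 2) ^ 2) ^ m / m.factorial))
    ((Real.summable_pow_div_factorial _).mul_left _) fun m => ?_
  have h1 : (1 : ℝ) ≤ (m + ν).factorial := by exact_mod_cast Nat.factorial_pos _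
  rw [Real.norm_eq_abs, abs_div, abs_pow, pow_add, pow_mul, sq_abs,
    abs_of_pos (by positivity : (0 : ℝ) < m.factorial * (m + ν).factorial), mul_comm, mul_div_assoc]
  gcongr
  exact le_mul_of_one_le_right (by positivity) h1

@[fun_prop]
theorem measurable_besselI (ν : ℕ) : Measurable (besselI ν) := by
  refine measurable_of_tendsto_metrizable (f := fun N x => ∑ m ∈ Finset.range N,
    (x / 2) ^ (2 * m + ν) / ((m.factorial : ℝ) * ((m + ν).factorial : ℝ))) (fun N => by fun_prop) ?_
  exact tendsto_pi_nhds.mpr fun x => (hasSum_besselI ν x).tendsto_sum_nat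

theorem besselI_pos {ν : ℕ} {x : ℝ} (hx : 0 < x) : 0 < besselI ν x :=
  (hasSum_besselI ν x).summable.tsum_pos (fun _ => by positivity) 0 (by positivity)

theorem besselI_zero_pos {x : ℝ} (hx : 0 ≤ x) : 0 < besselI 0 x :=
  (hasSum_besselI 0 x).summable.tsum_pos (fun _ => by positivity) 0 (by simp)

theorem besselI_nonneg (ν : ℕ) {x : ℝ} (hx : 0 ≤ x) : 0 ≤ besselI ν x :=
  tsum_nonneg fun _ => by positivity

theorem ofReal_besselI_zero {t : ℝ} (ht : 0 ≤ t) :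
    ENNReal.ofReal (besselI 0 (2 * Real.sqrt t)) =
      ∑' m : ℕ, ENNReal.ofReal (t ^ m / (m.factorial : ℝ) ^ 2) := by
  rw [besselI, ENNReal.ofReal_tsum_of_nonneg (fun _ => by positivity) (hasSum_besselI _ _).summable]
  refine tsum_congr fun m => ?_
  rw [mul_div_cancel_left₀ _ two_ne_zero, add_zero, add_zero, pow_mul, Real.sq_sqrt ht, ← sq]

/-- Only an inequality: at `t = 0` with `ν > 0` the quotient is `0` by the convention for division
by zero, while the series equals `1 / ν!`. An upper bound suffices for the mass estimate. -/
theorem ofReal_besselI_div_pow_le (ν : ℕ) {t : ℝ} (ht : 0 ≤ t) :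
    ENNReal.ofReal (besselI ν (2 * Real.sqrt t) / Real.sqrt t ^ ν) ≤
      ∑' m : ℕ, ENNReal.ofReal (t ^ m / (m.factorial * (m + ν).factorial : ℝ)) := by
  rw [besselI, ← tsum_div_const, ENNReal.ofReal_tsum_of_nonneg (fun _ => by positivity)
    ((hasSum_besselI _ _).summable.div_const _)]
  refine ENNReal.tsum_le_tsum fun m => ENNReal.ofReal_le_ofReal ?_
  rw [mul_div_cancel_left₀ _ two_ne_zero, pow_add, pow_mul, Real.sq_sqrt ht, div_right_comm]
  gcongr
  rw [mul_div_assoc]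
  exact mul_le_of_le_one_right (by positivity) (div_self_le_one _)

theorem lintegral_pow_mul_exp_neg (m : ℕ) {r : ℝ} (hr : 0 < r) :
    ∫⁻ z in Set.Ioi (0 : ℝ), ENNReal.ofReal (z ^ m * Real.exp (-(r * z))) =
      ENNReal.ofReal ((1 / r) ^ (m + 1) * m.factorial) := by
  have h := Real.integral_rpow_mul_exp_neg_mul_Ioi (a := m + 1) (by positivity) hr
  simp only [add_sub_cancel_right, Real.rpow_natCast, Real.Gamma_nat_eq_factorial] at h
  rw [← Nat.cast_succ, Real.rpow_natCast] at h
  rw [← h, ofReal_integral_eq_lintegral_ofReal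
    (Integrable.of_integral_ne_zero (h.trans_ne (by positivity)))]
  exact (ae_restrict_mem measurableSet_Ioi).mono fun z (hz : 0 < z) => by
    have := hz.le
    positivity

/-! ### The output density induced by a shell code -/

theorem varH_pos {κ : ℝ} (hκ : 0 ≤ κ) : 0 < varH κ := by unfold varH; positivity

/-- The integrand of `shellIntegral`. -/
def shellIntegrand (κ : ℝ) (nc : ℕ) (ρ s z : ℝ) : ℝ :=
  Real.exp (-((ρ * nc + (varH κ)⁻¹) * z)) / Real.sqrt (s * ρ * nc * z) ^ (nc - 1)
    * besselI 0 (2 * Real.sqrt (z * |muH κ| ^ 2 / varH κ ^ 2))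
    * besselI (nc - 1) (2 * Real.sqrt (s * ρ * nc * z))

theorem measurable_shellIntegrand (κ : ℝ) (nc : ℕ) (ρ : ℝ) :
    Measurable fun p : ℝ × ℝ => shellIntegrand κ nc ρ p.1 p.2 := by
  unfold shellIntegrand
  refine ((Measurable.div (by fun_prop) (by fun_prop)).mul ?_).mul ?_
  · exact (measurable_besselI 0).comp (by fun_prop)
  · exact (measurable_besselI (nc - 1)).comp (by fun_prop)

theorem shellIntegrand_nonneg (κ : ℝ) (nc : ℕ) (ρ s z : ℝ) : 0 ≤ shellIntegrand κ nc ρ s z :=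
  mul_nonneg (mul_nonneg (by positivity) (besselI_nonneg _ (by positivity)))
    (besselI_nonneg _ (by positivity))

theorem shellIntegrand_pos {κ : ℝ} {nc : ℕ} {ρ s z : ℝ} (hnc : 1 ≤ nc) (hρ : 0 < ρ)
    (hs : 0 < s) (hz : 0 < z) : 0 < shellIntegrand κ nc ρ s z := by
  have hn : (0 : ℝ) < nc := by exact_mod_cast hnc
  have h : 0 < s * ρ * nc * z := by positivity
  exact mul_pos (mul_pos (by positivity) (besselI_zero_pos (by positivity)))
    (besselI_pos (by positivity))

/-- `shellIntegral` as an extended nonnegative real. -/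
def shellLIntegral (κ : ℝ) (nc : ℕ) (ρ s : ℝ) : ENNReal :=
  ∫⁻ z in Set.Ioi (0 : ℝ), ENNReal.ofReal (shellIntegrand κ nc ρ s z)

@[fun_prop]
theorem measurable_shellLIntegral (κ : ℝ) (nc : ℕ) (ρ : ℝ) :
    Measurable (shellLIntegral κ nc ρ) :=
  (measurable_shellIntegrand κ nc ρ).ennreal_ofReal.lintegral_prod_right'

theorem shellIntegral_eq_toReal (κ : ℝ) (nc : ℕ) (ρ s : ℝ) :
    shellIntegral κ nc ρ s = (shellLIntegral κ nc ρ s).toReal :=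
  integral_eq_lintegral_of_nonneg_ae
    (Filter.Eventually.of_forall fun z => shellIntegrand_nonneg κ nc ρ s z)
    ((measurable_shellIntegrand κ nc ρ).comp measurable_prodMk_left).aestronglyMeasurable

theorem shellLIntegral_ne_zero {κ : ℝ} {nc : ℕ} {ρ s : ℝ} (hnc : 1 ≤ nc) (hρ : 0 < ρ)
    (hs : 0 < s) : shellLIntegral κ nc ρ s ≠ 0 := by
  refine ((setLIntegral_pos_iff ((measurable_shellIntegrand κ nc ρ).comp
    measurable_prodMk_left).ennreal_ofReal).mpr ?_).ne'
  have h : Set.Ioi (0 : ℝ) ⊆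
      Function.support (fun z => ENNReal.ofReal (shellIntegrand κ nc ρ s z)) ∩ Set.Ioi 0 :=
    fun z hz => ⟨(ENNReal.ofReal_pos.mpr (shellIntegrand_pos hnc hρ hs hz)).ne', hz⟩
  exact lt_of_lt_of_le (by simp) (measure_mono h)

/-- The moment `(m + d)! / d!` of `‖y‖²` cancels the factor `(m + d)!` in the Bessel series of order
`d`, which leaves the exponential series of `c`. -/
theorem lintegral_bessel_blockNoise_le (d : ℕ) {c : ℝ} (hc : 0 ≤ c) :
    ∫⁻ y, ENNReal.ofReal (besselI d (2 * Real.sqrt (normSqVec y * c)) /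
        Real.sqrt (normSqVec y * c) ^ d) ∂(blockNoise (d + 1)) ≤
      ENNReal.ofReal (Real.exp c / d.factorial) := by
  have hm (m : ℕ) : ∫⁻ y : Fin (d + 1) → ℂ,
      ENNReal.ofReal ((normSqVec y * c) ^ m / (m.factorial * (m + d).factorial : ℝ))
        ∂(blockNoise (d + 1)) = ENNReal.ofReal (c ^ m / m.factorial / d.factorial) := by
    have h (y : Fin (d + 1) → ℂ) :
        ENNReal.ofReal ((normSqVec y * c) ^ m / (m.factorial * (m + d).factorial : ℝ)) =
        ENNReal.ofReal (c ^ m / (m.factorial * (m + d).factorial : ℝ)) *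
          ENNReal.ofReal (normSqVec y) ^ m := by
      rw [← ENNReal.ofReal_pow (normSqVec_nonneg y), ← ENNReal.ofReal_mul (by positivity)]
      congr 1
      ring
    simp_rw [h]
    rw [lintegral_const_mul _ (by fun_prop), lintegral_normSqVec_pow, ← ENNReal.ofReal_natCast,
      ← ENNReal.ofReal_mul (by positivity), ← Nat.add_choose_mul_factorial_mul_factorial m d]
    congr 1
    have : ((m + d).choose d : ℝ) ≠ 0 := by
      exact_mod_cast (Nat.choose_pos (Nat.le_add_left d m)).ne'
    push_cast
    field_simp
  calc _ ≤ ∫⁻ y : Fin (d + 1) → ℂ, ∑' m : ℕ,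
        ENNReal.ofReal ((normSqVec y * c) ^ m / (m.factorial * (m + d).factorial : ℝ))
          ∂(blockNoise (d + 1)) :=
        lintegral_mono fun y => ofReal_besselI_div_pow_le d (mul_nonneg (normSqVec_nonneg y) hc)
    _ = ∑' m : ℕ, ENNReal.ofReal (c ^ m / m.factorial / d.factorial) := by
        rw [lintegral_tsum fun m => by fun_prop]
        exact tsum_congr hm
    _ = _ := by
        rw [← ENNReal.ofReal_tsum_of_nonneg (fun _ => by positivity)
          ((Real.summable_pow_div_factorial c).div_const _), tsum_div_const,
          Real.exp_eq_exp_ℝ, NormedSpace.exp_eq_tsum_div]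

/-- Termwise integration: the Gamma integral of `z ^ m` supplies `m!`, cancelling one of the two
factorials in `I_0`. -/
theorem lintegral_exp_mul_besselI_zero {v : ℝ} (hv : 0 < v) (a : ℝ) :
    ∫⁻ z in Set.Ioi (0 : ℝ), ENNReal.ofReal (Real.exp (-(v⁻¹ * z))) *
        ENNReal.ofReal (besselI 0 (2 * Real.sqrt (z * a ^ 2 / v ^ 2))) =
      ENNReal.ofReal (v * Real.exp (a ^ 2 / v)) := by
  calc _ = ∫⁻ z in Set.Ioi (0 : ℝ), ∑' m : ℕ,
        ENNReal.ofReal ((a ^ 2 / v ^ 2) ^ m / (m.factorial : ℝ) ^ 2) *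
          ENNReal.ofReal (z ^ m * Real.exp (-(v⁻¹ * z))) := by
        refine setLIntegral_congr_fun measurableSet_Ioi fun z (hz : 0 < z) => ?_
        rw [ofReal_besselI_zero (by positivity), ← ENNReal.tsum_mul_left]
        refine tsum_congr fun m => ?_
        rw [← ENNReal.ofReal_mul (by positivity), ← ENNReal.ofReal_mul (by positivity)]
        congr 1
        rw [mul_div_assoc, mul_pow]
        ring
    _ = ∑' m : ℕ, ENNReal.ofReal (v * ((a ^ 2 / v) ^ m / m.factorial)) := by
        rw [lintegral_tsum fun m => by fun_prop]
        refine tsum_congr fun m => ?_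
        rw [lintegral_const_mul _ (by fun_prop), lintegral_pow_mul_exp_neg m (inv_pos.mpr hv),
          ← ENNReal.ofReal_mul (by positivity)]
        congr 1
        rw [one_div, inv_inv, div_pow, div_pow, pow_succ v]
        field_simp
        ring
    _ = _ := by
        rw [← ENNReal.ofReal_tsum_of_nonneg (fun _ => by positivity)
          ((Real.summable_pow_div_factorial _).mul_left _), tsum_mul_left,
          Real.exp_eq_exp_ℝ, NormedSpace.exp_eq_tsum_div]

theorem lintegral_shellLIntegral_le {κ ρ : ℝ} (hκ : 0 ≤ κ) (hρ : 0 < ρ) (d : ℕ) :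
    ∫⁻ y, shellLIntegral κ (d + 1) ρ (normSqVec y) ∂(blockNoise (d + 1)) ≤
      ENNReal.ofReal (varH κ * Real.exp (|muH κ| ^ 2 / varH κ) / d.factorial) := by
  have hv := varH_pos hκ
  unfold shellLIntegral
  rw [lintegral_lintegral_swap (((measurable_shellIntegrand κ (d + 1) ρ).comp
    (((measurable_normSqVec.comp measurable_fst)).prodMk measurable_snd)).ennreal_ofReal.aemeasurable)]
  set n : ℝ := ((d + 1 : ℕ) : ℝ) with hn
  have hn0 : 0 < n := by positivity
  calc _ ≤ ∫⁻ z in Set.Ioi (0 : ℝ), ENNReal.ofReal (1 / d.factorial) *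
        (ENNReal.ofReal (Real.exp (-((varH κ)⁻¹ * z))) *
          ENNReal.ofReal (besselI 0 (2 * Real.sqrt (z * |muH κ| ^ 2 / varH κ ^ 2)))) := by
        refine setLIntegral_mono' measurableSet_Ioi fun z (hz : 0 < z) => ?_
        have hB := besselI_nonneg 0 (x := 2 * Real.sqrt (z * |muH κ| ^ 2 / varH κ ^ 2))
          (by positivity)
        have h (y : Fin (d + 1) → ℂ) :
            ENNReal.ofReal (shellIntegrand κ (d + 1) ρ (normSqVec y) z) =
            ENNReal.ofReal (Real.exp (-((ρ * n + (varH κ)⁻¹) * z)) *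
              besselI 0 (2 * Real.sqrt (z * |muH κ| ^ 2 / varH κ ^ 2))) *
            ENNReal.ofReal (besselI d (2 * Real.sqrt (normSqVec y * (ρ * n * z))) /
              Real.sqrt (normSqVec y * (ρ * n * z)) ^ d) := by
          rw [← ENNReal.ofReal_mul (mul_nonneg (Real.exp_nonneg _) hB), shellIntegrand,
            show normSqVec y * ρ * ((d + 1 : ℕ) : ℝ) * z = normSqVec y * (ρ * n * z) by
              rw [← hn]; ring, add_tsub_cancel_right]
          congr 1
          ring
        simp_rw [h]
        rw [lintegral_const_mul' _ _ ENNReal.ofReal_ne_top]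
        -- With `c = ρ n z`, the factor `e^c` from the integral over `y` cancels the part `e^{-ρ n
        -- z}` of the exponential weight.
        refine (mul_le_mul_right (lintegral_bessel_blockNoise_le d (by positivity)) _).trans_eq ?_
        rw [← ENNReal.ofReal_mul (mul_nonneg (Real.exp_nonneg _) hB),
          ← ENNReal.ofReal_mul (by positivity), ← ENNReal.ofReal_mul (by positivity)]
        congr 1
        rw [show -((ρ * n + (varH κ)⁻¹) * z) = -((varH κ)⁻¹ * z) - ρ * n * z by ring, Real.exp_sub]
        field_simp
    _ = _ := by
        rw [lintegral_const_mul' _ _ ENNReal.ofReal_ne_top,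
          lintegral_exp_mul_besselI_zero hv, ← ENNReal.ofReal_mul (by positivity)]
        congr 1
        ring

/-- The density, with respect to `blockNoise`, of the output law induced by a shell code. -/
def shellDensity (κ : ℝ) (nc : ℕ) (ρ : ℝ) (y : Fin nc → ℂ) : ENNReal :=
  ENNReal.ofReal (Real.exp (-(|muH κ| ^ 2 / varH κ)) * Real.Gamma nc / varH κ) *
    shellLIntegral κ nc ρ (normSqVec y)

theorem measurable_shellDensity (κ : ℝ) (nc : ℕ) (ρ : ℝ) : Measurable (shellDensity κ nc ρ) := by
  unfold shellDensity
  exact ((measurable_shellLIntegral κ nc ρ).comp measurable_normSqVec).const_mul _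

theorem lintegral_shellDensity_le_one {κ ρ : ℝ} {nc : ℕ} (hκ : 0 ≤ κ) (hρ : 0 < ρ) (hnc : 1 ≤ nc) :
    ∫⁻ y, shellDensity κ nc ρ y ∂(blockNoise nc) ≤ 1 := by
  obtain ⟨d, rfl⟩ := Nat.exists_eq_add_of_le' hnc
  have hv := varH_pos hκ
  unfold shellDensity
  rw [lintegral_const_mul' _ _ ENNReal.ofReal_ne_top]
  refine (mul_le_mul_right (lintegral_shellLIntegral_le hκ hρ d) _).trans_eq ?_
  rw [Nat.cast_succ, Real.Gamma_nat_eq_factorial, ← ENNReal.ofReal_mul (by positivity),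
    ← ENNReal.ofReal_one, Real.exp_neg]
  congr 1
  field_simp

instance nullSingletonClass_blockNoise {nc : ℕ} [NeZero nc] :
    NullSingletonClass (blockNoise nc) := by
  have (z : ℂ) : complexGaussian 0 1 {z} = 0 := by
    rw [complexGaussian_eq_withDensity _ one_pos]
    exact withDensity_absolutelyContinuous _ _ (measure_singleton z)
  have : NullSingletonClass (complexGaussian 0 1) := ⟨this⟩
  unfold blockNoise
  exact Measure.pi_nullSingletonClass 0

theorem ae_normSqVec_pos {nc : ℕ} (hnc : 1 ≤ nc) : ∀ᵐ y ∂(blockNoise nc), 0 < normSqVec y := by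
  have : NeZero nc := ⟨by omega⟩
  have h : ∀ᵐ y ∂(blockNoise nc), y ≠ 0 := by simp [ae_iff]
  filter_upwards [h] with y hy
  refine (normSqVec_nonneg y).lt_of_ne' fun h0 => hy (funext fun i => ?_)
  rw [normSqVec, Finset.sum_eq_zero_iff_of_nonneg fun _ _ => by positivity] at h0
  simpa using h0 i (Finset.mem_univ i)

/-- This legitimizes dividing by the shell density and excludes, almost everywhere, the default
values of the integral and the logarithm in `S`. Finiteness follows from the finite mass, positivity
from `y ≠ 0`. -/
theorem ae_shellLIntegral_ne {κ ρ : ℝ} {nc : ℕ} (hκ : 0 ≤ κ) (hρ : 0 < ρ) (hnc : 1 ≤ nc) :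
    ∀ᵐ y ∂(blockNoise nc), shellLIntegral κ nc ρ (normSqVec y) ≠ 0 ∧
      shellLIntegral κ nc ρ (normSqVec y) ≠ ⊤ := by
  have hfin : ∀ᵐ y ∂(blockNoise nc), shellLIntegral κ nc ρ (normSqVec y) < ⊤ := by
    refine ae_lt_top ((measurable_shellLIntegral κ nc ρ).comp measurable_normSqVec) ?_
    obtain ⟨d, rfl⟩ := Nat.exists_eq_add_of_le' hnc
    exact ((lintegral_shellLIntegral_le hκ hρ d).trans_lt ENNReal.ofReal_lt_top).ne
  filter_upwards [hfin, ae_normSqVec_pos hnc] with y h1 h2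
  exact ⟨shellLIntegral_ne_zero hnc hρ h2, h1.ne⟩

/-! ### The channel law of one block -/

/-- Law of the channel output `H x + W` in one block. -/
def blockLaw (κ : ℝ) {nc : ℕ} (x : Fin nc → ℂ) : Measure (Fin nc → ℂ) :=
  ((complexGaussian (muH κ : ℂ) (varH κ)).prod (blockNoise nc)).map fun p i => p.1 * x i + p.2 i

instance isProbabilityMeasure_blockLaw (κ : ℝ) {nc : ℕ} (x : Fin nc → ℂ) :
    IsProbabilityMeasure (blockLaw κ x) :=
  Measure.isProbabilityMeasure_map (by fun_prop)

/-- Fading and noise are both independent across blocks, so regrouping them as one pair per block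
exhibits the product. -/
theorem outputLaw_eq_pi (κ : ℝ) {ℓ nc : ℕ} (x : Blocks ℓ nc) :
    outputLaw κ x = Measure.pi fun k => blockLaw κ (x k) := by
  have hsf (k : Fin ℓ) : SigmaFinite
      (((complexGaussian (muH κ : ℂ) (varH κ)).prod (blockNoise nc)).map
        fun p i => p.1 * x k i + p.2 i) := by
    have := isProbabilityMeasure_blockLaw κ (x k)
    unfold blockLaw at this
    infer_instance
  unfold blockLaw
  rw [← Measure.pi_map_pi (f := fun k (p : ℂ × (Fin nc → ℂ)) i => p.1 * x k i + p.2 i)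
    fun k => by fun_prop]
  unfold outputLaw fadingLaw noiseLaw
  have h := (measurePreserving_arrowProdEquivProdArrow ℂ (Fin nc → ℂ) (Fin ℓ)
    (fun _ => complexGaussian (muH κ : ℂ) (varH κ)) (fun _ => blockNoise nc)).map_eq
  unfold blockNoise at h ⊢
  rw [← h, Measure.map_map (by fun_prop) (MeasurableEquiv.measurable _)]
  rfl

/-- The input `(√(nc ρ), 0, …, 0)`. -/
def axisInput (nc : ℕ) (ρ : ℝ) : Fin nc → ℂ := fun i =>
  if (i : ℕ) = 0 then ((Real.sqrt (nc * ρ) : ℝ) : ℂ) else 0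

@[fun_prop]
theorem measurable_wTilde (κ : ℝ) {nc : ℕ} (ρ : ℝ) : Measurable (wTilde κ (nc := nc) ρ) := by
  unfold wTilde
  refine measurable_pi_lambda _ fun i => ?_
  split_ifs <;> fun_prop

/-- Law of the `i`-th coordinate of the output for the input `axisInput`. -/
def axisCoordLaw (κ : ℝ) {nc : ℕ} (ρ : ℝ) (i : Fin nc) : Measure ℂ :=
  complexGaussian (if (i : ℕ) = 0 then ((muH κ * Real.sqrt (nc * ρ) : ℝ) : ℂ) else 0)
    (if (i : ℕ) = 0 then varH κ * nc * ρ + 1 else 1)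

instance isProbabilityMeasure_axisCoordLaw (κ : ℝ) {nc : ℕ} (ρ : ℝ) (i : Fin nc) :
    IsProbabilityMeasure (axisCoordLaw κ ρ i) := by
  unfold axisCoordLaw; infer_instance

theorem map_wTilde_blockNoise {κ ρ : ℝ} (hκ : 0 ≤ κ) (hρ : 0 < ρ) (nc : ℕ) :
    (blockNoise nc).map (wTilde κ ρ) = Measure.pi (axisCoordLaw κ (nc := nc) ρ) := by
  have hv := varH_pos hκ
  let f : Fin nc → ℂ → ℂ := fun i z => if (i : ℕ) = 0 then
    ((muH κ * Real.sqrt (nc * ρ) : ℝ) : ℂ) + ((Real.sqrt (varH κ * nc * ρ + 1) : ℝ) : ℂ) * z else z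
  have hf (i : Fin nc) : Measurable (f i) := by
    by_cases hi : (i : ℕ) = 0
    · simp only [f, hi, if_true]; fun_prop
    · simp only [f, hi, if_false]; fun_prop
  have hmap (i : Fin nc) : (complexGaussian 0 1).map (f i) = axisCoordLaw κ ρ i := by
    by_cases hi : (i : ℕ) = 0
    · simp only [f, hi, if_true, axisCoordLaw]
      rw [complexGaussian_map_mul_add _ zero_le_one, Real.sq_sqrt (by positivity)]
      simp
    · simp only [f, hi, if_false, axisCoordLaw]
      exact Measure.map_id
  have hsf (i : Fin nc) : SigmaFinite ((complexGaussian 0 1).map (f i)) := by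
    rw [hmap]; infer_instance
  rw [show axisCoordLaw κ ρ = fun i => (complexGaussian 0 1).map (f i) from
    funext fun i => (hmap i).symm, ← Measure.pi_map_pi fun i => (hf i).aemeasurable]
  rfl

theorem complexGaussian_prod_map_mul_add {κ ρ : ℝ} (hκ : 0 ≤ κ) (hρ : 0 < ρ) (nc : ℕ) :
    ((complexGaussian (muH κ : ℂ) (varH κ)).prod (complexGaussian 0 1)).map
        (fun p => p.1 * ((Real.sqrt (nc * ρ) : ℝ) : ℂ) + p.2) =
      complexGaussian ((muH κ * Real.sqrt (nc * ρ) : ℝ) : ℂ) (varH κ * nc * ρ + 1) := by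
  have hv := varH_pos hκ
  have h := complexGaussian_map_mul_add (muH κ : ℂ) hv.le (Real.sqrt (nc * ρ)) 0
  rw [Real.sq_sqrt (by positivity)] at h
  have h2 := complexGaussian_conv (0 + (Real.sqrt (nc * ρ) : ℂ) * (muH κ : ℂ)) 0
    (v₁ := nc * ρ * varH κ) (v₂ := 1) (by positivity) zero_le_one
  have hid : complexGaussian 0 1 = (complexGaussian 0 1).map id := Measure.map_id.symm
  rw [← h, Measure.conv] at h2
  rw [hid, Measure.map_prod_map _ _ (by fun_prop) measurable_id,
    Measure.map_map (by fun_prop) (by fun_prop)] at h2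
  convert h2 using 2
  · ext p
    simp [mul_comm]
  · simp [mul_comm]
  · ring

/-- The fading enters the first coordinate only, so the coordinates stay independent: the first is a
sum of two independent Gaussians, the others are pure noise. -/
theorem blockLaw_axisInput {κ ρ : ℝ} (hκ : 0 ≤ κ) (hρ : 0 < ρ) {nc : ℕ} (hnc : 1 ≤ nc) :
    blockLaw κ (axisInput nc ρ) = (blockNoise nc).map (wTilde κ ρ) := by
  obtain ⟨d, rfl⟩ := Nat.exists_eq_add_of_le' hnc
  rw [map_wTilde_blockNoise hκ hρ]
  refine (Measure.pi_eq fun s hs => ?_).symm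
  have hf : Measurable fun (p : ℂ × (Fin (d + 1) → ℂ)) i =>
    p.1 * axisInput (d + 1) ρ i + p.2 i := by fun_prop
  rw [blockLaw, Measure.map_apply hf (MeasurableSet.univ_pi hs),
    Measure.prod_apply (hf (MeasurableSet.univ_pi hs))]
  have hpre (h : ℂ) : Prod.mk h ⁻¹' ((fun (p : ℂ × (Fin (d + 1) → ℂ)) i =>
      p.1 * axisInput (d + 1) ρ i + p.2 i) ⁻¹' Set.univ.pi s) =
      Set.univ.pi fun i => (fun w => h * axisInput (d + 1) ρ i + w) ⁻¹' s i := by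
    ext w
    simp
  simp_rw [hpre, blockNoise, Measure.pi_pi, Fin.prod_univ_succ]
  have hsucc (i : Fin d) (h : ℂ) :
      (fun w => h * axisInput (d + 1) ρ i.succ + w) ⁻¹' s i.succ = s i.succ := by
    simp [axisInput]
  simp_rw [hsucc]
  have hcoord (i : Fin d) : axisCoordLaw κ ρ i.succ = complexGaussian 0 1 := by
    simp [axisCoordLaw]
  simp_rw [hcoord]
  rw [lintegral_mul_const' _ _ (ENNReal.prod_ne_top fun i _ => measure_ne_top _ _)]
  congr 1
  have h0 : axisCoordLaw κ ρ (0 : Fin (d + 1)) = _ :=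
    (complexGaussian_prod_map_mul_add hκ hρ (d + 1)).symm
  have hf0 : Measurable fun p : ℂ × ℂ =>
    p.1 * ((Real.sqrt ((d + 1 : ℕ) * ρ) : ℝ) : ℂ) + p.2 := by fun_prop
  rw [h0, Measure.map_apply hf0 (hs 0), Measure.prod_apply (hf0 (hs 0))]
  rfl

/-! ### Unitary invariance -/

theorem exists_linearEquiv_axisInput {ρ : ℝ} (hρ : 0 < ρ) {nc : ℕ} (hnc : 1 ≤ nc)
    {x : Fin nc → ℂ} (hx : normSqVec x = nc * ρ) :
    ∃ V : (Fin nc → ℂ) ≃ₗ[ℂ] (Fin nc → ℂ), V (axisInput nc ρ) = x ∧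
      ∀ y, normSqVec (V y) = normSqVec y := by
  have hnorm (y : EuclideanSpace ℂ (Fin nc)) : normSqVec (WithLp.ofLp y) = ‖y‖ ^ 2 :=
    (EuclideanSpace.norm_sq_eq y).symm
  have hP : 0 < (nc * ρ : ℝ) := by
    have : (0 : ℝ) < nc := by exact_mod_cast hnc
    positivity
  set r := Real.sqrt (nc * ρ) with hr
  have hr0 : 0 < r := Real.sqrt_pos.mpr hP
  let i₀ : Fin nc := ⟨0, hnc⟩
  let X : EuclideanSpace ℂ (Fin nc) := WithLp.toLp 2 x
  have hX : ‖X‖ = r := by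
    rw [hr, ← hx, show x = WithLp.ofLp X from rfl, hnorm, Real.sqrt_sq (norm_nonneg _)]
  -- Only the value at `i₀` matters: the unit vector along `x` is completed to an orthonormal basis,
  -- and `V` sends the standard basis to it.
  let v : Fin nc → EuclideanSpace ℂ (Fin nc) := fun _ => ((r⁻¹ : ℝ) : ℂ) • X
  have hv : Orthonormal ℂ (({i₀} : Set (Fin nc)).domRestrict v) := by
    refine ⟨fun i => ?_, fun i j hij => (hij (Subsingleton.elim i j)).elim⟩
    change ‖((r⁻¹ : ℝ) : ℂ) • X‖ = 1
    rw [norm_smul, hX, Complex.norm_real, Real.norm_of_nonneg (by positivity),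
      inv_mul_cancel₀ hr0.ne']
  obtain ⟨b, hb⟩ := hv.exists_orthonormalBasis_extension_of_card_eq (by simp)
  have hb0 := hb i₀ rfl
  let e := WithLp.linearEquiv 2 ℂ (Fin nc → ℂ)
  refine ⟨e.symm.trans (b.repr.symm.toLinearEquiv.trans e), ?_, fun y => ?_⟩
  · have h1 : e.symm (axisInput nc ρ) = EuclideanSpace.single i₀ (r : ℂ) := by
      ext i
      by_cases hi : (i : ℕ) = 0
      · obtain rfl : i = i₀ := Fin.ext hi
        simp [e, axisInput, i₀, hr]
      · have : i ≠ i₀ := fun h => hi (congrArg Fin.val h)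
        simp [e, axisInput, hi, this]
    have h2 : (EuclideanSpace.single i₀ (r : ℂ)) = (r : ℂ) • EuclideanSpace.single i₀ (1 : ℂ) := by
      ext i; simp
    have h3 : b.repr.symm (e.symm (axisInput nc ρ)) = X := by
      rw [h1, h2, map_smul, OrthonormalBasis.repr_symm_single, hb0, smul_smul, ← Complex.ofReal_mul,
        mul_inv_cancel₀ hr0.ne', Complex.ofReal_one, one_smul]
    change e (b.repr.symm (e.symm (axisInput nc ρ))) = x
    rw [h3]
    rfl
  · change normSqVec (WithLp.ofLp (b.repr.symm (e.symm y))) = _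
    rw [hnorm, LinearIsometryEquiv.norm_map, ← hnorm]
    rfl

theorem measurable_linearEquiv {n : ℕ} (V : (Fin n → ℂ) ≃ₗ[ℂ] (Fin n → ℂ)) : Measurable V :=
  (LinearMap.continuous_of_finiteDimensional V.toLinearMap).measurable

theorem blockNoise_eq_withDensity (n : ℕ) :
    blockNoise n = volume.withDensity fun y =>
      ENNReal.ofReal (Real.pi⁻¹ ^ n * Real.exp (-normSqVec y)) := by
  have h := complexGaussian_eq_withDensity 0 one_pos
  have : SigmaFinite (volume.withDensity (complexGaussianPDF 0 1)) := by rw [← h]; infer_instance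
  rw [blockNoise, h, pi_withDensity fun _ => measurable_complexGaussianPDF 0 1, ← volume_pi]
  congr 1
  ext y
  unfold complexGaussianPDF
  rw [← ENNReal.ofReal_prod_of_nonneg fun _ _ => by positivity, Finset.prod_mul_distrib,
    ← Real.exp_sum]
  simp [normSqVec]

/-- The Gaussian density depends on the norm alone, and a linear bijection scales Lebesgue measure
by some constant. Comparing total masses forces that constant to be 1, so no determinant is
computed. -/
theorem map_blockNoise_of_normSqVec {n : ℕ} (V : (Fin n → ℂ) ≃ₗ[ℂ] (Fin n → ℂ))
    (hV : ∀ y, normSqVec (V y) = normSqVec y) : (blockNoise n).map V = blockNoise n := by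
  have hVm := measurable_linearEquiv V
  obtain ⟨c, hc⟩ : ∃ c : ENNReal, (volume : Measure (Fin n → ℂ)).map V = c • volume :=
    ⟨_, Measure.map_linearMap_addHaar_eq_smul_addHaar volume
      (f := (V.restrictScalars ℝ).toLinearMap) (LinearEquiv.isUnit_det' _).ne_zero⟩
  have hcV : (blockNoise n).map V = c • blockNoise n := by
    have h := map_withDensity_comp hVm volume
      (h := fun y => ENNReal.ofReal (Real.pi⁻¹ ^ n * Real.exp (-normSqVec y))) (by fun_prop)
    simp_rw [hV] at h
    rw [blockNoise_eq_withDensity, h, hc, withDensity_smul_measure]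
  have : IsProbabilityMeasure ((blockNoise n).map V) :=
    Measure.isProbabilityMeasure_map hVm.aemeasurable
  have h1 : ((blockNoise n).map V) Set.univ = 1 := measure_univ
  rw [hcV, Measure.smul_apply, measure_univ, smul_eq_mul, mul_one] at h1
  rw [hcV, h1, one_smul]

/-- By linearity `V (h x + w) = h (V x) + V w`, and `V w` is again standard noise. -/
theorem map_blockLaw {κ : ℝ} {n : ℕ} (V : (Fin n → ℂ) ≃ₗ[ℂ] (Fin n → ℂ))
    (hV : ∀ y, normSqVec (V y) = normSqVec y) (x : Fin n → ℂ) :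
    (blockLaw κ x).map V = blockLaw κ (V x) := by
  have hVm := measurable_linearEquiv V
  rw [blockLaw, Measure.map_map hVm (by fun_prop), blockLaw]
  nth_rw 2 [← map_blockNoise_of_normSqVec V hV]
  rw [← Measure.map_id (μ := complexGaussian _ _), Measure.map_prod_map _ _ measurable_id hVm,
    Measure.map_map (by fun_prop) (by fun_prop), Measure.map_id]
  congr 1
  ext p i
  have : (fun i => p.1 * x i + p.2 i) = p.1 • x + p.2 := rfl
  simp only [Function.comp_apply, this, map_add, map_smul]
  rfl

/-! ### Density of the channel output with respect to the shell output law -/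

theorem complexGaussian_eq_withDensity_standard (m : ℂ) {v : ℝ} (hv : 0 < v) :
    complexGaussian m v = (complexGaussian 0 1).withDensity
      fun z => complexGaussianPDF m v z / complexGaussianPDF 0 1 z := by
  have hm := measurable_complexGaussianPDF
  have h := withDensity_mul volume (hm 0 1) ((hm m v).div (hm 0 1))
  rw [complexGaussian_eq_withDensity m hv, complexGaussian_eq_withDensity 0 one_pos]
  refine Eq.trans ?_ h
  congr 1
  ext z
  refine (ENNReal.mul_div_cancel ?_ ENNReal.ofReal_ne_top).symm
  exact (ENNReal.ofReal_pos.mpr (by positivity)).ne'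

theorem complexGaussianPDF_div (m : ℂ) {v : ℝ} (hv : 0 < v) (z : ℂ) :
    complexGaussianPDF m v z / complexGaussianPDF 0 1 z =
      ENNReal.ofReal (v⁻¹ * Real.exp (‖z‖ ^ 2 - ‖z - m‖ ^ 2 / v)) := by
  rw [complexGaussianPDF, complexGaussianPDF, ← ENNReal.ofReal_div_of_pos (by positivity),
    sub_zero, mul_one, div_one, mul_inv, mul_div_mul_comm, mul_div_assoc, ← Real.exp_sub]
  congr 1
  rw [show -‖z - m‖ ^ 2 / v - -‖z‖ ^ 2 = ‖z‖ ^ 2 - ‖z - m‖ ^ 2 / v by ring]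
  field_simp

/-- Density, with respect to `blockNoise`, of the output law for the input `axisInput`. -/
def axisDensity (κ : ℝ) {nc : ℕ} (ρ : ℝ) (y : Fin nc → ℂ) : ENNReal :=
  ∏ i : Fin nc, complexGaussianPDF
    (if (i : ℕ) = 0 then ((muH κ * Real.sqrt (nc * ρ) : ℝ) : ℂ) else 0)
    (if (i : ℕ) = 0 then varH κ * nc * ρ + 1 else 1) (y i) / complexGaussianPDF 0 1 (y i)

theorem measurable_axisDensity (κ : ℝ) {nc : ℕ} (ρ : ℝ) :
    Measurable (axisDensity κ (nc := nc) ρ) :=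
  Finset.measurable_prod _ fun i _ => ((measurable_complexGaussianPDF _ _).div
    (measurable_complexGaussianPDF _ _)).comp (measurable_pi_apply i)

theorem map_wTilde_eq_withDensity {κ ρ : ℝ} (hκ : 0 ≤ κ) (hρ : 0 < ρ) (nc : ℕ) :
    (blockNoise nc).map (wTilde κ ρ) = (blockNoise nc).withDensity (axisDensity κ ρ) := by
  have hv := varH_pos hκ
  let f : Fin nc → ℂ → ENNReal := fun i z => complexGaussianPDF
    (if (i : ℕ) = 0 then ((muH κ * Real.sqrt (nc * ρ) : ℝ) : ℂ) else 0)
    (if (i : ℕ) = 0 then varH κ * nc * ρ + 1 else 1) z / complexGaussianPDF 0 1 z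
  have h (i : Fin nc) : axisCoordLaw κ ρ i = (complexGaussian 0 1).withDensity (f i) :=
    complexGaussian_eq_withDensity_standard _ (by split_ifs <;> positivity)
  have hsf (i : Fin nc) : SigmaFinite ((complexGaussian 0 1).withDensity (f i)) := by
    rw [← h]; infer_instance
  have hf (i : Fin nc) : Measurable (f i) :=
    (measurable_complexGaussianPDF _ _).div (measurable_complexGaussianPDF _ _)
  rw [map_wTilde_blockNoise hκ hρ, show axisCoordLaw κ ρ = _ from funext h, pi_withDensity hf]
  rfl

/-- Standardizing the first coordinate of `W̃` returns `W_1`, so the Gaussian exponent of the output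
density becomes `-‖w‖²`. -/
theorem axisDensity_wTilde {κ ρ : ℝ} (hκ : 0 ≤ κ) (hρ : 0 < ρ) {nc : ℕ} (hnc : 1 ≤ nc)
    (w : Fin nc → ℂ) :
    axisDensity κ ρ (wTilde κ ρ w) = ENNReal.ofReal ((varH κ * nc * ρ + 1)⁻¹ *
      Real.exp (normSqVec (wTilde κ ρ w) - normSqVec w)) := by
  have hv := varH_pos hκ
  obtain ⟨d, rfl⟩ := Nat.exists_eq_add_of_le' hnc
  set a := varH κ * (d + 1 : ℕ) * ρ + 1 with ha
  have ha0 : 0 < a := by positivity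
  have hcoord (i : Fin (d + 1)) : complexGaussianPDF
      (if (i : ℕ) = 0 then ((muH κ * Real.sqrt ((d + 1 : ℕ) * ρ) : ℝ) : ℂ) else 0)
      (if (i : ℕ) = 0 then a else 1) (wTilde κ ρ w i) / complexGaussianPDF 0 1 (wTilde κ ρ w i) =
      ENNReal.ofReal ((if (i : ℕ) = 0 then a⁻¹ else 1) *
        Real.exp (‖wTilde κ ρ w i‖ ^ 2 - ‖w i‖ ^ 2)) := by
    rw [complexGaussianPDF_div _ (by split_ifs <;> positivity)]
    by_cases hi : (i : ℕ) = 0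
    · have h1 : ‖wTilde κ ρ w i - ((muH κ * Real.sqrt ((d + 1 : ℕ) * ρ) : ℝ) : ℂ)‖ ^ 2 / a =
          ‖w i‖ ^ 2 := by
        rw [wTilde, if_pos hi, add_sub_cancel_left, norm_mul, Complex.norm_real, mul_pow,
          Real.norm_of_nonneg (Real.sqrt_nonneg _), Real.sq_sqrt ha0.le,
          mul_div_cancel_left₀ _ ha0.ne']
      simp only [hi, if_true, h1]
    · have h1 : wTilde κ ρ w i = w i := if_neg hi
      simp [hi, h1]
  rw [axisDensity, Finset.prod_congr rfl fun i _ => hcoord i,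
    ← ENNReal.ofReal_prod_of_nonneg fun i _ => by split_ifs <;> positivity,
    Finset.prod_mul_distrib, ← Real.exp_sum, Finset.sum_sub_distrib]
  congr 2
  simp

/-- The output law induced by a shell code in one block. -/
def shellLaw (κ : ℝ) (nc : ℕ) (ρ : ℝ) : Measure (Fin nc → ℂ) :=
  (blockNoise nc).withDensity (shellDensity κ nc ρ)

theorem shellLaw_univ_le_one {κ ρ : ℝ} {nc : ℕ} (hκ : 0 ≤ κ) (hρ : 0 < ρ) (hnc : 1 ≤ nc) :
    shellLaw κ nc ρ Set.univ ≤ 1 := by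
  rw [shellLaw, withDensity_apply _ MeasurableSet.univ, Measure.restrict_univ]
  exact lintegral_shellDensity_le_one hκ hρ hnc

theorem map_shellLaw {κ ρ : ℝ} {nc : ℕ} (V : (Fin nc → ℂ) ≃ₗ[ℂ] (Fin nc → ℂ))
    (hV : ∀ y, normSqVec (V y) = normSqVec y) :
    (shellLaw κ nc ρ).map V = shellLaw κ nc ρ := by
  have h := map_withDensity_comp (measurable_linearEquiv V) (blockNoise nc)
    (measurable_shellDensity κ nc ρ)
  rw [map_blockNoise_of_normSqVec V hV] at h
  rw [shellLaw]
  refine Eq.trans ?_ h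
  refine congrArg (fun f => ((blockNoise nc).withDensity f).map V) (funext fun y => ?_)
  rw [shellDensity, shellDensity, hV]

/-- Density of the output law for `axisInput` with respect to `shellLaw`. -/
def likelihoodRatio (κ : ℝ) {nc : ℕ} (ρ : ℝ) (y : Fin nc → ℂ) : ENNReal :=
  axisDensity κ ρ y / shellDensity κ nc ρ y

theorem measurable_likelihoodRatio (κ : ℝ) {nc : ℕ} (ρ : ℝ) :
    Measurable (likelihoodRatio κ (nc := nc) ρ) :=
  (measurable_axisDensity κ ρ).div (measurable_shellDensity κ nc ρ)

theorem shellConst_pos {κ : ℝ} {nc : ℕ} (hκ : 0 ≤ κ) (hnc : 1 ≤ nc) :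
    0 < Real.exp (-(|muH κ| ^ 2 / varH κ)) * Real.Gamma nc / varH κ := by
  have hv := varH_pos hκ
  have hG := Real.Gamma_pos_of_pos (show (0 : ℝ) < nc by exact_mod_cast hnc)
  positivity

theorem map_wTilde_eq_shellLaw_withDensity {κ ρ : ℝ} {nc : ℕ} (hκ : 0 ≤ κ) (hρ : 0 < ρ)
    (hnc : 1 ≤ nc) :
    (blockNoise nc).map (wTilde κ ρ) = (shellLaw κ nc ρ).withDensity (likelihoodRatio κ ρ) := by
  rw [shellLaw, ← withDensity_mul _ (measurable_shellDensity κ nc ρ)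
    (measurable_likelihoodRatio κ ρ), map_wTilde_eq_withDensity hκ hρ]
  refine withDensity_congr_ae ?_
  filter_upwards [ae_shellLIntegral_ne hκ hρ hnc] with y hy
  refine (ENNReal.mul_div_cancel ?_ ?_).symm
  · exact mul_ne_zero (ENNReal.ofReal_pos.mpr (shellConst_pos hκ hnc)).ne' hy.1
  · exact ENNReal.mul_ne_top ENNReal.ofReal_ne_top hy.2

theorem ae_likelihoodRatio_wTilde {κ ρ : ℝ} {nc : ℕ} (hκ : 0 ≤ κ) (hρ : 0 < ρ) (hnc : 1 ≤ nc) :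
    ∀ᵐ w ∂(blockNoise nc),
      likelihoodRatio κ ρ (wTilde κ ρ w) = ENNReal.ofReal (Real.exp (S κ ρ w)) := by
  have hv := varH_pos hκ
  have h : ∀ᵐ y ∂((blockNoise nc).map (wTilde κ ρ)),
      shellLIntegral κ nc ρ (normSqVec y) ≠ 0 ∧ shellLIntegral κ nc ρ (normSqVec y) ≠ ⊤ := by
    rw [map_wTilde_eq_withDensity hκ hρ]
    -- The law of `W̃` is absolutely continuous with respect to the noise law, so null sets carry
    -- over.
    exact (withDensity_absolutelyContinuous _ _).ae_le (ae_shellLIntegral_ne hκ hρ hnc)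
  filter_upwards [ae_of_ae_map (measurable_wTilde κ ρ).aemeasurable h] with w hw
  have hc := shellConst_pos hκ hnc
  have hG := Real.Gamma_pos_of_pos (show (0 : ℝ) < nc by exact_mod_cast hnc)
  have hI : 0 < shellIntegral κ nc ρ (normSqVec (wTilde κ ρ w)) := by
    rw [shellIntegral_eq_toReal]; exact ENNReal.toReal_pos hw.1 hw.2
  rw [likelihoodRatio, axisDensity_wTilde hκ hρ hnc, shellDensity, ← ENNReal.ofReal_toReal hw.2,
    ← shellIntegral_eq_toReal, ← ENNReal.ofReal_mul hc.le, ← ENNReal.ofReal_div_of_pos (by positivity)]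
  congr 1
  rw [S, Real.exp_sub, Real.exp_sub, Real.exp_sub, Real.exp_log hI, Real.exp_log (by positivity), Real.exp_neg,
    Real.exp_sub, Real.exp_add]
  field_simp

/-! ### The converse bound -/

/-- The map `Φ` rotates each block separately; it reduces every admissible codeword to `axisInput`
in all blocks while fixing the reference measure. -/
theorem exists_map_eq_outputLaw {κ ρ : ℝ} {ℓ nc : ℕ} (hκ : 0 ≤ κ) (hρ : 0 < ρ) (hnc : 1 ≤ nc)
    (x : Blocks ℓ nc) (hx : ∀ k, normSqVec (x k) = nc * ρ) :
    ∃ Φ : Blocks ℓ nc → Blocks ℓ nc, Measurable Φ ∧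
      outputLaw κ x = (noiseLaw ℓ nc).map (fun w => Φ fun k => wTilde κ ρ (w k)) ∧
      (Measure.pi fun _ : Fin ℓ => shellLaw κ nc ρ).map Φ =
        Measure.pi fun _ : Fin ℓ => shellLaw κ nc ρ := by
  choose V hVx hV using fun k => exists_linearEquiv_axisInput hρ hnc (hx k)
  have hVm (k : Fin ℓ) := measurable_linearEquiv (V k)
  refine ⟨fun y k => V k (y k), by fun_prop, ?_, ?_⟩
  · have hk (k : Fin ℓ) :
        blockLaw κ (x k) = (blockNoise nc).map (fun w => V k (wTilde κ ρ w)) := by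
      rw [← hVx k, ← map_blockLaw (V k) (hV k), blockLaw_axisInput hκ hρ hnc,
        Measure.map_map (hVm k) (measurable_wTilde κ ρ)]
      rfl
    have hsf (k : Fin ℓ) : SigmaFinite ((blockNoise nc).map (fun w => V k (wTilde κ ρ w))) := by
      rw [← hk]; infer_instance
    rw [outputLaw_eq_pi]
    simp_rw [hk]
    have hm (k : Fin ℓ) : Measurable fun w => V k (wTilde κ ρ w) := by fun_prop
    rw [← Measure.pi_map_pi fun k => (hm k).aemeasurable]
    rfl
  · have : IsFiniteMeasure (shellLaw κ nc ρ) :=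
      ⟨(shellLaw_univ_le_one hκ hρ hnc).trans_lt ENNReal.one_lt_top⟩
    rw [Measure.pi_map_pi fun k => (hVm k).aemeasurable]
    simp_rw [map_shellLaw _ (hV _)]

theorem noiseLaw_map_wTilde {κ ρ : ℝ} {nc : ℕ} (ℓ : ℕ) (hκ : 0 ≤ κ) (hρ : 0 < ρ) (hnc : 1 ≤ nc) :
    (noiseLaw ℓ nc).map (fun w k => wTilde κ ρ (w k)) =
      (Measure.pi fun _ : Fin ℓ => shellLaw κ nc ρ).withDensity
        fun y => ∏ k, likelihoodRatio κ ρ (y k) := by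
  have : IsFiniteMeasure (shellLaw κ nc ρ) :=
    ⟨(shellLaw_univ_le_one hκ hρ hnc).trans_lt ENNReal.one_lt_top⟩
  have : IsProbabilityMeasure ((blockNoise nc).map (wTilde κ ρ)) :=
    Measure.isProbabilityMeasure_map (measurable_wTilde κ ρ).aemeasurable
  have hsf : SigmaFinite ((shellLaw κ nc ρ).withDensity (likelihoodRatio κ ρ)) := by
    rw [← map_wTilde_eq_shellLaw_withDensity hκ hρ hnc]; infer_instance
  rw [← pi_withDensity fun _ => measurable_likelihoodRatio κ ρ,
    ← map_wTilde_eq_shellLaw_withDensity hκ hρ hnc,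
    ← Measure.pi_map_pi fun _ => (measurable_wTilde κ ρ).aemeasurable]
  rfl

/-- If the decoder's output lies outside `B`, the second term pays; otherwise the likelihood ratio
is at most `e^t`, and the change of measure to `Q` costs at most that factor. -/
theorem noiseLaw_sum_S_le {κ ρ : ℝ} {ℓ nc : ℕ} (hκ : 0 ≤ κ) (hρ : 0 < ρ) (hnc : 1 ≤ nc)
    (x : Blocks ℓ nc) (hx : ∀ k, normSqVec (x k) = nc * ρ) (t : ℝ) {B : Set (Blocks ℓ nc)}
    (hB : MeasurableSet B) :
    noiseLaw ℓ nc {w | ∑ k, S κ ρ (w k) ≤ t} ≤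
      ENNReal.ofReal (Real.exp t) * (Measure.pi fun _ : Fin ℓ => shellLaw κ nc ρ) B +
        outputLaw κ x Bᶜ := by
  obtain ⟨Φ, hΦ, hout, hQ⟩ := exists_map_eq_outputLaw hκ hρ hnc x hx
  set Q := Measure.pi fun _ : Fin ℓ => shellLaw κ nc ρ
  let T : Blocks ℓ nc → Blocks ℓ nc := fun w k => wTilde κ ρ (w k)
  let R : Blocks ℓ nc → ENNReal := fun y => ∏ k, likelihoodRatio κ ρ (y k)
  have hT : Measurable T := by fun_prop
  have hR : Measurable R := Finset.measurable_prod _ fun k _ =>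
    (measurable_likelihoodRatio κ ρ).comp (measurable_pi_apply k)
  have hRS : ∀ᵐ w ∂(noiseLaw ℓ nc), R (T w) = ENNReal.ofReal (Real.exp (∑ k, S κ ρ (w k))) := by
    have h (k : Fin ℓ) : ∀ᵐ w ∂(noiseLaw ℓ nc),
        likelihoodRatio κ ρ (wTilde κ ρ (w k)) = ENNReal.ofReal (Real.exp (S κ ρ (w k))) :=
      (measurePreserving_eval (fun _ : Fin ℓ => blockNoise nc) k).quasiMeasurePreserving.ae
        (ae_likelihoodRatio_wTilde hκ hρ hnc)
    filter_upwards [ae_all_iff.mpr h] with w hw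
    rw [Real.exp_sum, ENNReal.ofReal_prod_of_nonneg fun _ _ => Real.exp_nonneg _]
    exact Finset.prod_congr rfl fun k _ => hw k
  let D := Φ ⁻¹' B ∩ {y | R y ≤ ENNReal.ofReal (Real.exp t)}
  have hD : MeasurableSet D := (hΦ hB).inter (measurableSet_le hR measurable_const)
  have hsub : {w | ∑ k, S κ ρ (w k) ≤ t} ≤ᵐ[noiseLaw ℓ nc]
      (T ⁻¹' D ∪ (fun w => Φ (T w)) ⁻¹' Bᶜ : Set (Blocks ℓ nc)) := by
    filter_upwards [hRS] with w hw (hwt : ∑ k, S κ ρ (w k) ≤ t)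
    by_cases hwB : Φ (T w) ∈ B
    · refine Or.inl ⟨hwB, ?_⟩
      change R (T w) ≤ _
      rw [hw]
      exact ENNReal.ofReal_le_ofReal (Real.exp_le_exp.mpr hwt)
    · exact Or.inr hwB
  refine (measure_mono_ae hsub).trans ((measure_union_le _ _).trans (add_le_add ?_ ?_))
  · rw [← Measure.map_apply hT hD, noiseLaw_map_wTilde ℓ hκ hρ hnc, withDensity_apply _ hD]
    calc _ ≤ ∫⁻ _ in D, ENNReal.ofReal (Real.exp t) ∂Q :=
          setLIntegral_mono' hD fun y hy => hy.2
      _ = ENNReal.ofReal (Real.exp t) * Q D := setLIntegral_const _ _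
      _ ≤ _ := by
        -- Invariance of `Q` under `Φ` turns `Q B` into `Q (Φ ⁻¹' B)`, which contains `D`.
        rw [← hQ, Measure.map_apply hΦ hB, hQ]
        gcongr
        exact Set.inter_subset_left
  · have hΦT : Measurable fun w : Blocks ℓ nc => Φ fun k => wTilde κ ρ (w k) := hΦ.comp hT
    rw [hout, Measure.map_apply hΦT hB.compl]

theorem Code.card_mul_le {κ ρ ε : ℝ} {ℓ nc M : ℕ} (hκ : 0 ≤ κ) (hρ : 0 < ρ) (hnc : 1 ≤ nc)
    (C : Code κ ℓ nc M ε ρ) (t : ℝ) :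
    M * (probSumLe κ ℓ nc ρ t - ε) ≤ Real.exp t := by
  set Q := Measure.pi fun _ : Fin ℓ => shellLaw κ nc ρ with hQdef
  have : IsFiniteMeasure (shellLaw κ nc ρ) :=
    ⟨(shellLaw_univ_le_one hκ hρ hnc).trans_lt ENNReal.one_lt_top⟩
  have hQ1 : Q Set.univ ≤ 1 := by
    rw [hQdef, Measure.pi_univ]
    exact Finset.prod_le_one' fun _ _ => shellLaw_univ_le_one hκ hρ hnc
  have hdec (j : Fin M) : MeasurableSet (C.dec ⁻¹' {j}) :=
    C.measurable_dec (measurableSet_singleton j)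
  have hj (j : Fin M) : probSumLe κ ℓ nc ρ t ≤
      Real.exp t * Q.real (C.dec ⁻¹' {j}) + (outputLaw κ (C.enc j)).real {y | C.dec y ≠ j} := by
    have h := noiseLaw_sum_S_le hκ hρ hnc (C.enc j) (C.power j) t (hdec j)
    have : IsProbabilityMeasure (outputLaw κ (C.enc j)) := by
      rw [outputLaw_eq_pi]; infer_instance
    have h' := ENNReal.toReal_mono (ENNReal.add_ne_top.mpr
      ⟨ENNReal.mul_ne_top ENNReal.ofReal_ne_top (measure_ne_top _ _), measure_ne_top _ _⟩) h
    rwa [ENNReal.toReal_add (ENNReal.mul_ne_top ENNReal.ofReal_ne_top (measure_ne_top _ _))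
      (measure_ne_top _ _), ENNReal.toReal_mul, ENNReal.toReal_ofReal (Real.exp_nonneg t)] at h'
  have hsum := Finset.sum_le_sum fun j (_ : j ∈ Finset.univ) => hj j
  rw [Finset.sum_const, Finset.card_univ, Fintype.card_fin, nsmul_eq_mul, Finset.sum_add_distrib,
    ← Finset.mul_sum] at hsum
  -- The decoding regions partition the output space, so `Q` having mass at most 1 is enough.
  have hQsum : ∑ j, Q.real (C.dec ⁻¹' {j}) ≤ 1 := by
    have h := sum_measureReal_preimage_singleton (μ := Q) Finset.univ (f := C.dec) fun j _ => hdec j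
    rw [h, Finset.coe_univ, Set.preimage_univ]
    exact ENNReal.toReal_le_of_le_ofReal zero_le_one (by simpa using hQ1)
  have hM : (0 : ℝ) < M := by exact_mod_cast C.one_le
  have herr := C.avg_error
  rw [one_div, inv_mul_le_iff₀ hM] at herr
  have := mul_le_mul_of_nonneg_left hQsum (Real.exp_nonneg t)
  linarith

end

end RicianBlockFading

theorem theorem2 (κ ρ ε : ℝ) (ℓ nc : ℕ) (hκ : 0 ≤ κ) (hρ : 0 < ρ) (hℓ : 1 ≤ ℓ) (hnc : 1 ≤ nc) :
    RicianBlockFading.maxRate κ ℓ nc ε ρ ≤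
      ⨅ (t : ℝ) (_ : 0 ≤ t),
        ((1 / (ℓ * nc * Real.log 2) : ℝ) : EReal) *
          ((t : EReal) -
            RicianBlockFading.logPos (RicianBlockFading.probSumLe κ ℓ nc ρ t - ε)) := by
  refine le_iInf₂ fun t _ => sSup_le ?_
  rintro r ⟨M, ⟨C⟩, rfl⟩
  have hl : (0 : ℝ) < ℓ := by exact_mod_cast hℓ
  have hn : (0 : ℝ) < nc := by exact_mod_cast hnc
  have hlog := Real.log_pos one_lt_two
  -- When the difference is not positive, its `logPos` is `⊥` and the bound is `⊤`; otherwise all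
  -- quantities are real.
  rcases le_or_gt (RicianBlockFading.probSumLe κ ℓ nc ρ t - ε) 0 with h0 | h0
  · rw [RicianBlockFading.logPos, ENNReal.log_ofReal, if_pos h0, EReal.coe_sub_bot,
      EReal.coe_mul_top_of_pos (by positivity)]
    exact le_top
  · have hM : (0 : ℝ) < M := by exact_mod_cast C.one_le
    rw [RicianBlockFading.logPos, ENNReal.log_ofReal_of_pos h0, ← EReal.coe_sub, ← EReal.coe_mul,
      EReal.coe_le_coe_iff]
    have h := Real.log_le_log (by positivity) (C.card_mul_le hκ hρ hnc t)
    rw [Real.log_exp, Real.log_mul hM.ne' h0.ne'] at h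
    rw [Real.logb, div_div, mul_comm (Real.log 2), div_eq_mul_one_div, mul_comm]
    exact mul_le_mul_of_nonneg_left (by linarith) (by positivity)
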